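/- Let $\mathbb{N}=\{1,2,3,\dots\}$ and $\mathbb{T}=\{z\in\mathbb{C}:|z|=1\}$. A symmetry on $\mathbb{C}^d$ is a linear operator $J$ with $J=J^*=J^{-1}$, and $\mathrm{Sym}_3(\mathbb{C}^d)$ denotes the set of all products $J_1J_2J_3$ of three symmetries on $\mathbb{C}^d$. Let $d\ge 4$ be an even integer and write $d=2r$. Let $\alpha\neq\beta$ in $\mathbb{T}$ satisfy Condition (P) with $s=r$, that is, (i) $\alpha^r\beta^r\in\{-1,1\}$, and (ii) if $i,j\in\mathbb{N}$ and $\alpha^i\beta^j\in\{-1,1\}$, then $i+j\ge d$. Let $V:=\alpha I_r\oplus\beta I_r$, acting on $\mathbb{C}^r\oplus\mathbb{C}^r=\mathbb{C}^{d}$. Then $V\in\mathrm{Sym}_3(\mathbb{C}^{d})$ if and only if at least one of the following four conditions holds: (a) $d$ is divisible by $4$, $(\alpha\beta)^r=-1$, and $|(\alpha\beta)^{2j-1}-1|<|\alpha-\beta|$ for all $1\le j\le r$; (b) $d$ is not divisible by $4$, and $|(\alpha\beta)^{2j-1}-1|<|\alpha-\beta|$ for all $1\le j\le r$; (c) $d$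 is not divisible by $4$, $(\alpha\beta)^r=-1$, and $\left|e^{i\pi\frac{r-1}{r}}-1\right|<|\alpha-\beta|$; (d) $d$ is not divisible by $4$, $(\alpha\beta)^r=-1$, and $|1-\alpha^{2j+1}\beta^{2j-1}|<|\alpha-\beta|$ for all $1\le j\le r-1$. -/

import Mathlib

/-- A symmetry on the Hilbert space with orthonormal basis indexed by `n`, written as a matrix:
`J = J* = J⁻¹`. -/
def IsSymmetryMatrix {n : Type*} [Fintype n] [DecidableEq n] (J : Matrix n n ℂ) : Prop :=
  J.IsHermitian ∧ J * J = 1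

/-- The set of all products `J₁ J₂ ⋯ Jₖ` of `k` symmetries. -/
def SymProd (k : ℕ) (n : Type*) [Fintype n] [DecidableEq n] : Set (Matrix n n ℂ) :=
  {V | ∃ J : Fin k → Matrix n n ℂ, (∀ i, IsSymmetryMatrix (J i)) ∧ V = (List.ofFn J).prod}

/-- Condition (P) for the pair `α, β` and the multiplicities `r, s`, where `d = r + s`.
In the second clause `i, j` range over the positive integers. -/
def ConditionP (r s : ℕ) (α β : ℂ) : Prop :=
  (α ^ r * β ^ s = -1 ∨ α ^ r * β ^ s = 1) ∧
    ∀ i j : ℕ, 1 ≤ i → 1 ≤ j → (α ^ i * β ^ j = -1 ∨ α ^ i * β ^ j = 1) → r + s ≤ i + j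

/-- The operator `α I_r ⊕ β I_s` on `ℂ^r ⊕ ℂ^s`. -/
def twoEigMatrix (r s : ℕ) (α β : ℂ) : Matrix (Fin r ⊕ Fin s) (Fin r ⊕ Fin s) ℂ :=
  Matrix.fromBlocks (α • 1) 0 0 (β • 1)

/-! ### Distances on the unit circle -/

/-! Membership in `Sym_3` and the disjunction of (a)–(d) are both equivalent to `chordBound r < ‖α -
β‖`, which says that `α / β` lies at angle less than `π / r` from `-1`. Write `V` for the block
matrix and `γ = α * β`; Condition (P) makes `γ ^ 2` a primitive `r`-th root of unity, so the numbers
in the conditions run through cosets of the `r`-th roots of unity.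

Necessity. If `V = J₀ J₁ J₂`, then `V J₂ = J₀ J₁ =: U`. As a product of two symmetries, `U` has a
spectrum stable under `l ↦ l⁻¹`. As `V J₂`, it has with each eigenvalue `l` also `-γ / l`, together
with `‖1 - γ / l ^ 2‖ < ‖α - β‖`, unless `l ^ 2` is `α ^ 2` or `β ^ 2`. Composing the two moves
multiplies eigenvalues by `-γ`, and following an orbit gives the inequality on a whole coset of
roots of unity, or on the coset of `α / β` (or `β / α`) minus that point. Such a coset cannot avoid
the closed arc of angle `π / r` around `-1`, which gives the bound (`chordBound_lt_of_spectrum`,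
`eigenvalue_twoEigMatrix_mul`).

Sufficiency. The orbit `l k = (-γ) ^ k * α` is realized: `J₁ J₂` is taken diagonal with entries `l
(k + 1)` and `(l k)⁻¹`, indices cyclic, and each such pair is turned by a 2×2 symmetry into a matrix
with eigenvalues `α, β` (`blockFactorization_of_norm_lt`, `twoEigMatrix_mem_symProd_of_blocks`). -/

lemma star_eq_inv_of_norm_eq_one {z : ℂ} (hz : ‖z‖ = 1) : star z = z⁻¹ := by
  rw [Complex.inv_def, Complex.normSq_eq_norm_sq, hz]; simp

lemma norm_one_add_exp_mul_I (θ : ℝ) :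
    ‖1 + Complex.exp (θ * Complex.I)‖ = 2 * |Real.cos (θ / 2)| := by
  have h : (1 : ℂ) + Complex.exp (θ * Complex.I)
      = Complex.exp ((θ / 2 : ℝ) * Complex.I) * ((2 * Real.cos (θ / 2) : ℝ) : ℂ) := by
    have h1 : Complex.exp (θ * Complex.I)
        = Complex.exp ((θ / 2 : ℝ) * Complex.I) * Complex.exp ((θ / 2 : ℝ) * Complex.I) := by
      rw [← Complex.exp_add]; congr 1; push_cast; ring
    have h2 : Complex.exp ((θ / 2 : ℝ) * Complex.I) * Complex.exp (-((θ / 2 : ℝ) : ℂ) * Complex.I)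
        = 1 := by
      rw [← Complex.exp_add]; simp
    rw [h1]
    push_cast at h2 ⊢
    rw [Complex.two_cos, mul_add, h2]
    ring
  rw [h, norm_mul, Complex.norm_exp_ofReal_mul_I, Complex.norm_real, Real.norm_eq_abs, abs_mul]
  simp

lemma norm_one_add_exp_of_abs_le_pi {θ : ℝ} (h : |θ| ≤ Real.pi) :
    ‖1 + Complex.exp (θ * Complex.I)‖ = 2 * Real.cos (|θ| / 2) := by
  rw [norm_one_add_exp_mul_I, ← Real.cos_abs (θ / 2), abs_div, abs_two, abs_of_nonneg]
  apply Real.cos_nonneg_of_neg_pi_div_two_le_of_le <;> linarith [abs_nonneg θ, Real.pi_pos]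

/-- The distance from `1` to the points of the unit circle at angle `π / r` from `-1`. -/
noncomputable def chordBound (r : ℕ) : ℝ := 2 * Real.cos (Real.pi / r / 2)

lemma pi_div_le_pi (r : ℕ) : Real.pi / r ≤ Real.pi := by
  rcases Nat.eq_zero_or_pos r with h | h
  · simp [h, Real.pi_pos.le]
  · exact div_le_self Real.pi_pos.le (by exact_mod_cast h)

lemma chordBound_lt_iff {r : ℕ} {θ : ℝ} (h : |θ| ≤ Real.pi) :
    chordBound r < ‖1 + Complex.exp (θ * Complex.I)‖ ↔ |θ| < Real.pi / r := by
  rw [norm_one_add_exp_of_abs_le_pi h, chordBound, mul_lt_mul_iff_right₀ two_pos,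
    Real.strictAntiOn_cos.lt_iff_gt, div_lt_div_iff_of_pos_right two_pos]
  · constructor
    · have : 0 ≤ Real.pi / r := by positivity
      linarith
    · linarith [pi_div_le_pi r, Real.pi_pos]
  · constructor <;> linarith [abs_nonneg θ]

lemma chordBound_eq {r : ℕ} {θ : ℝ} (h : |θ| = Real.pi / r) :
    ‖1 + Complex.exp (θ * Complex.I)‖ = chordBound r := by
  rw [norm_one_add_exp_of_abs_le_pi (h ▸ pi_div_le_pi r), chordBound, h]

lemma exists_arg {w : ℂ} (hw : ‖w‖ = 1) :
    ∃ θ : ℝ, |θ| ≤ Real.pi ∧ w = Complex.exp (θ * Complex.I) := by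
  refine ⟨w.arg, Complex.abs_arg_le_pi w, ?_⟩
  have := Complex.norm_mul_exp_arg_mul_I w
  rw [hw] at this
  simpa using this.symm

/-- If `w` has angle `θ`, then `r * θ` is an odd multiple of `π`, so `|θ| ≥ π / r`. -/
lemma norm_one_add_le_chordBound {r : ℕ} (hr : 0 < r) {w : ℂ} (hw : ‖w‖ = 1) (h : w ^ r = -1) :
    ‖1 + w‖ ≤ chordBound r := by
  obtain ⟨θ, hθ, rfl⟩ := exists_arg hw
  by_contra! hlt
  rw [chordBound_lt_iff hθ, lt_div_iff₀ (by positivity)] at hlt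
  rw [← Complex.exp_nat_mul, ← Complex.exp_pi_mul_I, Complex.exp_eq_exp_iff_exists_int] at h
  obtain ⟨n, hn⟩ := h
  have h2 : (r : ℝ) * θ = Real.pi + n * (2 * Real.pi) := by
    have := congrArg Complex.im hn
    simpa using this
  have h3 : |Real.pi + n * (2 * Real.pi)| < Real.pi := by
    rw [← h2, abs_mul, Nat.abs_cast]; linarith
  rw [abs_lt] at h3
  have hpi := Real.pi_pos
  have h4 : (-1 : ℝ) < n := by nlinarith
  have h5 : (n : ℝ) < 0 := by nlinarith
  have h4' : (-1 : ℤ) < n := by exact_mod_cast h4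
  have h5' : n < 0 := by exact_mod_cast h5
  omega

/-- Two points at angle less than `π / r` from `1` differ by less than `2π / r`, the spacing of the
`r`-th roots of unity. -/
lemma norm_one_add_mul_lt {r : ℕ} (hr : 0 < r) {w ξ : ℂ} (hw : ‖w‖ = 1) (h : ξ ^ r = 1)
    (hξ : ξ ≠ 1) (hlt : chordBound r < ‖1 + w‖) : ‖1 + w * ξ‖ < ‖1 + w‖ := by
  by_contra! hle
  have hξn : ‖ξ‖ = 1 := Complex.norm_eq_one_of_pow_eq_one h hr.ne'
  obtain ⟨φ, hφ, hwφ⟩ := exists_arg (w := w * ξ) (by rw [norm_mul, hw, hξn, one_mul])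
  obtain ⟨θ, hθ, rfl⟩ := exists_arg hw
  have hlt' := lt_of_lt_of_le hlt hle
  rw [hwφ, chordBound_lt_iff hφ, lt_div_iff₀ (by positivity)] at hlt'
  rw [chordBound_lt_iff hθ, lt_div_iff₀ (by positivity)] at hlt
  have hξe : ξ = Complex.exp (((φ - θ : ℝ) : ℂ) * Complex.I) := by
    push_cast
    rw [sub_mul, Complex.exp_sub, ← hwφ, mul_div_cancel_left₀ _ (Complex.exp_ne_zero _)]
  rw [hξe, ← Complex.exp_nat_mul, Complex.exp_eq_one_iff] at h
  obtain ⟨n, hn⟩ := h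
  have h2 : (r : ℝ) * (φ - θ) = n * (2 * Real.pi) := by
    have := congrArg Complex.im hn
    simpa using this
  have h3 : |(r : ℝ) * (φ - θ)| < 2 * Real.pi := by
    rw [abs_mul, Nat.abs_cast]
    have : |φ - θ| ≤ |φ| + |θ| := abs_sub _ _
    have hr' : (0 : ℝ) < r := by exact_mod_cast hr
    nlinarith
  rw [h2, abs_lt] at h3
  have hpi := Real.pi_pos
  have h4 : (-1 : ℝ) < n := by nlinarith
  have h5 : (n : ℝ) < 1 := by nlinarith
  have h4' : (-1 : ℤ) < n := by exact_mod_cast h4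
  have h5' : n < 1 := by exact_mod_cast h5
  have h6 : n = 0 := by omega
  rw [h6] at h2
  have h7 : φ - θ = 0 := by
    have : (r : ℝ) ≠ 0 := by positivity
    simpa [this] using h2
  apply hξ
  rw [hξe, h7]
  simp

/-- A coset of the `r`-th roots of unity either has a point strictly inside the arc of angle `π / r`
around `-1`, or contains both its end points. -/
lemma exists_chordBound_le {r : ℕ} (hr : 2 ≤ r) {w : ℂ} (hw : ‖w‖ = 1) :
    (∃ ξ : ℂ, ξ ^ r = 1 ∧ chordBound r < ‖1 + w * ξ‖) ∨
      ∃ ξ ξ' : ℂ, ξ ^ r = 1 ∧ ξ' ^ r = 1 ∧ ξ ≠ ξ' ∧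
        ‖1 + w * ξ‖ = chordBound r ∧ ‖1 + w * ξ'‖ = chordBound r := by
  obtain ⟨θ, -, rfl⟩ := exists_arg hw
  have hr0 : (0 : ℝ) < r := by positivity
  have hrC : (r : ℂ) ≠ 0 := by exact_mod_cast hr0.ne'
  have hpi := Real.pi_pos
  have hr2 : (2 : ℝ) ≤ r := by exact_mod_cast hr
  set a : ℝ := Real.pi / r with ha
  have ha0 : 0 < a := by positivity
  have ha2 : 2 * a ≤ Real.pi := by
    rw [ha]; rw [← mul_div_assoc, div_le_iff₀ hr0]; nlinarith
  -- Removing `m` steps of the spacing `2 * a` leaves an angle in `[0, 2 * a)`. Its position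
  -- relative to the midpoint `a` decides which neighbour is nearer to angle `0`; a tie gives both
  -- end points.
  let m : ℤ := ⌊θ / (2 * a)⌋
  let ρ : ℤ → ℂ := fun k => Complex.exp (((-(k * (2 * a)) : ℝ) : ℂ) * Complex.I)
  have hρ : ∀ k, ρ k ^ r = 1 := by
    intro k
    simp only [ρ]
    rw [← Complex.exp_nat_mul, Complex.exp_eq_one_iff]
    refine ⟨-k, ?_⟩
    rw [ha]; push_cast; field_simp
  have hmul : ∀ k : ℤ, Complex.exp (θ * Complex.I) * ρ k
      = Complex.exp (((θ - k * (2 * a) : ℝ) : ℂ) * Complex.I) := by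
    intro k
    simp only [ρ]
    rw [← Complex.exp_add]; congr 1; push_cast; ring
  have h1 : (m : ℝ) * (2 * a) ≤ θ := by
    rw [← le_div_iff₀ (by positivity)]; exact Int.floor_le _
  have h2 : θ < (m + 1 : ℝ) * (2 * a) := by
    rw [← div_lt_iff₀ (by positivity)]; exact Int.lt_floor_add_one _
  rcases lt_trichotomy (θ - m * (2 * a)) a with h | h | h
  · refine Or.inl ⟨ρ m, hρ m, ?_⟩
    have hab : |θ - m * (2 * a)| < a := by rw [abs_lt]; constructor <;> linarith
    rw [hmul, chordBound_lt_iff (by linarith)]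
    exact hab
  · refine Or.inr ⟨ρ m, ρ (m + 1), hρ _, hρ _, ?_, ?_, ?_⟩
    · intro heq
      have h3 := hmul m
      have h4 := hmul (m + 1)
      rw [heq, h4, Complex.exp_eq_exp_iff_exists_int] at h3
      obtain ⟨n, hn⟩ := h3
      have h5 := congrArg Complex.im hn
      have h6 : θ - (m + 1) * (2 * a) = θ - m * (2 * a) + n * (2 * Real.pi) := by
        simpa using h5
      have h7 : (n : ℝ) < 0 := by nlinarith
      have h8 : (-1 : ℝ) < n := by nlinarith
      have h7' : n < 0 := by exact_mod_cast h7
      have h8' : (-1 : ℤ) < n := by exact_mod_cast h8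
      omega
    · rw [hmul]; apply chordBound_eq; rw [h, abs_of_pos ha0]
    · rw [hmul]; apply chordBound_eq
      have : θ - ((m + 1 : ℤ) : ℝ) * (2 * a) = -a := by push_cast; linarith
      rw [this, abs_neg, abs_of_pos ha0]
  · refine Or.inl ⟨ρ (m + 1), hρ _, ?_⟩
    have hab : |θ - ((m + 1 : ℤ) : ℝ) * (2 * a)| < a := by
      push_cast; rw [abs_lt]; constructor <;> linarith
    rw [hmul, chordBound_lt_iff (by linarith)]
    exact hab

/-- One exceptional point `ξ₀` with only a weak inequality is harmless: a coset that reaches the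
bound without exceeding it does so at two points, one of which is not `ξ₀`. -/
lemma chordBound_lt_of_forall {r : ℕ} (hr : 2 ≤ r) {z : ℂ} (hz : ‖z‖ = 1) {c : ℝ} (ξ₀ : ℂ)
    (hle : ‖1 - z * ξ₀‖ ≤ c) (h : ∀ ξ : ℂ, ξ ^ r = 1 → ξ ≠ ξ₀ → ‖1 - z * ξ‖ < c) :
    chordBound r < c := by
  have hneg : ∀ ξ, ‖1 + -z * ξ‖ = ‖1 - z * ξ‖ := fun ξ => by congr 1; ring
  rcases exists_chordBound_le hr (w := -z) (by rwa [norm_neg]) with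
    ⟨ξ, h1, h2⟩ | ⟨ξ, ξ', h1, h1', hne, h2, h2'⟩
  · rw [hneg] at h2
    by_cases hξ : ξ = ξ₀
    · subst hξ; exact h2.trans_le hle
    · exact h2.trans (h ξ h1 hξ)
  · rw [hneg] at h2 h2'
    by_cases hξ : ξ = ξ₀
    · rw [← h2']; exact h _ h1' (fun e => hne (hξ.trans e.symm))
    · rw [← h2]; exact h _ h1 hξ

lemma norm_exp_sub_one_eq_chordBound {r : ℕ} (hr : 0 < r) :
    ‖Complex.exp (Complex.I * (((r : ℂ) - 1) / (r : ℂ)) * (Real.pi : ℂ)) - 1‖ = chordBound r := by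
  have hrC : (r : ℂ) ≠ 0 := by exact_mod_cast hr.ne'
  have h : Complex.exp (Complex.I * (((r : ℂ) - 1) / (r : ℂ)) * (Real.pi : ℂ))
      = - Complex.exp (((-(Real.pi / r) : ℝ) : ℂ) * Complex.I) := by
    rw [← neg_one_mul (Complex.exp _), ← Complex.exp_pi_mul_I, ← Complex.exp_add]
    congr 1; push_cast; field_simp; ring
  rw [h, ← chordBound_eq (θ := -(Real.pi / r)) (by rw [abs_neg, abs_of_nonneg (by positivity)]),
    ← norm_neg]
  congr 1; ring

/-! ### Consequences of Condition (P) -/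

lemma ConditionP.pow_sq {r : ℕ} {α β : ℂ} (hP : ConditionP r r α β) :
    ((α * β) ^ r) ^ 2 = 1 := by
  rw [mul_pow]
  rcases hP.1 with h | h <;> rw [h] <;> norm_num

lemma ConditionP.le_of_sq {r : ℕ} {α β : ℂ} (hP : ConditionP r r α β) {i j : ℕ} (hi : 1 ≤ i)
    (hj : 1 ≤ j) (h : (α ^ i * β ^ j) ^ 2 = 1) : r + r ≤ i + j :=
  hP.2 i j hi hj (sq_eq_one_iff.1 h).symm

lemma ConditionP.symm {r : ℕ} {α β : ℂ} (hP : ConditionP r r α β) : ConditionP r r β α := by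
  refine ⟨by simpa only [mul_comm] using hP.1, fun i j hi hj h => ?_⟩
  rw [add_comm i j]
  exact hP.2 j i hj hi (by simpa only [mul_comm] using h)

lemma ConditionP.isPrimitiveRoot {r : ℕ} {α β : ℂ} (hP : ConditionP r r α β) (hr : 0 < r) :
    IsPrimitiveRoot ((α * β) ^ 2) r := by
  refine IsPrimitiveRoot.mk_of_lt _ hr (by rw [pow_right_comm]; exact hP.pow_sq) fun l hl hlr h => ?_
  have := hP.le_of_sq (i := l) (j := l) hl hl (by rw [← mul_pow, pow_right_comm]; exact h)
  omega

/-- Otherwise `α ^ (r - 2) * β ^ r` would be `±1`, against the minimality in (P). For `r = 2` the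
exponent `r - 2` is not positive, so smaller exponents are examined by hand. -/
lemma ConditionP.pow_four_ne_one {r : ℕ} {α β : ℂ} (hP : ConditionP r r α β) (hr : 2 ≤ r) :
    α ^ 4 ≠ 1 := by
  intro h
  have hs := hP.pow_sq
  obtain rfl | hr3 := hr.eq_or_lt
  · have hβ : β ^ 4 = 1 := by
      have : ((α * β) ^ 2) ^ 2 = α ^ 4 * β ^ 4 := by ring
      rwa [this, h, one_mul] at hs
    have hα2 : (α ^ 2) ^ 2 = 1 := by rw [← h]; ring
    have hβ2 : (β ^ 2) ^ 2 = 1 := by rw [← hβ]; ring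
    rcases sq_eq_one_iff.1 hα2 with h1 | h1
    · have := hP.le_of_sq (i := 1) (j := 2) le_rfl (by norm_num) (by
        calc (α ^ 1 * β ^ 2) ^ 2 = α ^ 2 * β ^ 4 := by ring
          _ = 1 := by rw [h1, hβ, one_mul])
      omega
    · rcases sq_eq_one_iff.1 hβ2 with h2 | h2
      · have := hP.le_of_sq (i := 2) (j := 1) (by norm_num) le_rfl (by
          calc (α ^ 2 * β ^ 1) ^ 2 = α ^ 4 * β ^ 2 := by ring
            _ = 1 := by rw [h2, h, one_mul])
        omega
      · have := hP.le_of_sq (i := 1) (j := 1) le_rfl le_rfl (by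
          calc (α ^ 1 * β ^ 1) ^ 2 = α ^ 2 * β ^ 2 := by ring
            _ = 1 := by rw [h1, h2]; norm_num)
        omega
  · obtain ⟨k, rfl⟩ : ∃ k, r = k + 2 := ⟨r - 2, by omega⟩
    have := hP.le_of_sq (i := k) (j := k + 2) (by omega) (by omega) (by
      calc (α ^ k * β ^ (k + 2)) ^ 2 = α ^ 4 * (α ^ k * β ^ (k + 2)) ^ 2 := by rw [h, one_mul]
        _ = ((α * β) ^ (k + 2)) ^ 2 := by ring
        _ = 1 := hs)
    omega

lemma ConditionP.pow_eq_neg_one {r : ℕ} {α β : ℂ} (hP : ConditionP r r α β) (hr : 0 < r)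
    (he : Even r) : (α * β) ^ r = -1 := by
  rcases sq_eq_one_iff.1 hP.pow_sq with h | h
  · obtain ⟨k, rfl⟩ := he
    have := hP.le_of_sq (i := k) (j := k) (by omega) (by omega) (by
      rw [← mul_pow, ← pow_mul, mul_two]; exact h)
    omega
  · exact h

/-! ### The inequalities in terms of the chord bound -/

/-- If every other point of the coset of `α / β` modulo the `r`-th roots of unity is closer to `1` than
`α / β` is, then `α / β` lies strictly inside the arc of angle `π / r` around `-1`. -/
lemma chordBound_lt_of_forall_pow {r : ℕ} {α β : ℂ} (hr : 2 ≤ r) (hα : ‖α‖ = 1) (hβ : ‖β‖ = 1)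
    (hP : ConditionP r r α β)
    (h : ∀ k, k + 2 ≤ r → ‖1 - α ^ 2 * (α * β) ^ (2 * k + 1)‖ < ‖α - β‖) :
    chordBound r < ‖α - β‖ := by
  have hβ0 : β ≠ 0 := by rintro rfl; simp at hβ
  refine chordBound_lt_of_forall hr (z := α / β) (by rw [norm_div, hα, hβ, div_one]) 1 ?_ ?_
  · rw [mul_one, ← norm_neg, show -(1 - α / β) = (α - β) / β by field_simp; ring, norm_div, hβ,
      div_one]
  · intro ξ hξ hne
    have : NeZero r := ⟨by omega⟩
    obtain ⟨j, hj, rfl⟩ := (hP.isPrimitiveRoot (by omega)).eq_pow_of_pow_eq_one hξ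
    obtain ⟨k, rfl⟩ : ∃ k, j = k + 1 := ⟨j - 1, by
      have : j ≠ 0 := by rintro rfl; simp at hne
      omega⟩
    convert h k (by omega) using 3
    field_simp
    ring

lemma chordBound_lt_of_forall_coset {r : ℕ} {α β : ℂ} (hr : 2 ≤ r) {z : ℂ} (hz : ‖z‖ = 1)
    (hP : ConditionP r r α β) {c : ℝ} (h : ∀ k < r, ‖1 - z * ((α * β) ^ 2) ^ k‖ < c) :
    chordBound r < c := by
  have h0 := h 0 (by omega)
  refine chordBound_lt_of_forall hr hz 1 (by simpa using h0.le) fun ξ hξ _ => ?_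
  have : NeZero r := ⟨by omega⟩
  obtain ⟨k, hk, rfl⟩ := (hP.isPrimitiveRoot (by omega)).eq_pow_of_pow_eq_one hξ
  exact h k hk

lemma norm_one_sub_lt_of_chordBound_lt {r : ℕ} {α β : ℂ} (hα : ‖α‖ = 1)
    (hβ : ‖β‖ = 1) (hP : ConditionP r r α β) (hlt : chordBound r < ‖α - β‖) {k : ℕ}
    (hk : k + 2 ≤ r) : ‖1 - α ^ 2 * (α * β) ^ (2 * k + 1)‖ < ‖α - β‖ := by
  have hβ0 : β ≠ 0 := by rintro rfl; simp at hβ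
  have hprim := hP.isPrimitiveRoot (by omega)
  have hw : ‖-(α / β)‖ = 1 := by rw [norm_neg, norm_div, hα, hβ, div_one]
  have heq : ‖1 + -(α / β)‖ = ‖α - β‖ := by
    rw [← norm_neg, show -(1 + -(α / β)) = (α - β) / β by field_simp; ring, norm_div, hβ, div_one]
  have := norm_one_add_mul_lt (r := r) (by omega) hw (ξ := ((α * β) ^ 2) ^ (k + 1))
    (by rw [pow_right_comm, hprim.pow_eq_one, one_pow])
    (hprim.pow_ne_one_of_pos_of_lt (by omega) (by omega)) (by rw [heq]; exact hlt)
  rw [heq] at this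
  convert this using 2
  field_simp
  ring

lemma norm_pow_sub_one_le_chordBound {r : ℕ} {γ : ℂ} (hr : 0 < r) (hγ : ‖γ‖ = 1)
    (h : (-γ) ^ r = -1) {j : ℕ} (hj : 1 ≤ j) (hs : (γ ^ r) ^ 2 = 1) :
    ‖γ ^ (2 * j - 1) - 1‖ ≤ chordBound r := by
  obtain ⟨k, rfl⟩ : ∃ k, j = k + 1 := ⟨j - 1, by omega⟩
  have := norm_one_add_le_chordBound hr (w := -γ * (γ ^ 2) ^ k)
    (by rw [norm_mul, norm_neg, hγ, norm_pow, norm_pow, hγ]; simp)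
    (by rw [mul_pow, h, pow_right_comm, pow_right_comm γ 2 r, hs, one_pow, mul_one])
  rwa [← norm_neg, show -(1 + -γ * (γ ^ 2) ^ k) = γ ^ (2 * (k + 1) - 1) - 1 by
    rw [show 2 * (k + 1) - 1 = 2 * k + 1 by omega]; ring] at this

/-- The odd powers of `γ = α * β` fill a full coset of the `r`-th roots of unity, so (a) and (b)
imply the bound. They follow from it when `(-γ) ^ r = -1`, which holds for even `r`, and for odd `r`
with `γ ^ r = 1`. In the remaining case (c) is the bound itself. Condition (d) concerns the coset of
`α / β` without that point. -/
lemma chordBound_lt_iff_conditions {d r : ℕ} (hd : 4 ≤ d) (hdr : d = r + r) {α β : ℂ}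
    (hα : ‖α‖ = 1) (hβ : ‖β‖ = 1) (hP : ConditionP r r α β) :
    chordBound r < ‖α - β‖ ↔
      ((4 ∣ d ∧ (α * β) ^ r = -1 ∧
          ∀ j : ℕ, 1 ≤ j → j ≤ r → ‖(α * β) ^ (2 * j - 1) - 1‖ < ‖α - β‖) ∨
        (¬ 4 ∣ d ∧
          ∀ j : ℕ, 1 ≤ j → j ≤ r → ‖(α * β) ^ (2 * j - 1) - 1‖ < ‖α - β‖) ∨
        (¬ 4 ∣ d ∧ (α * β) ^ r = -1 ∧
          ‖Complex.exp (Complex.I * (((r : ℂ) - 1) / (r : ℂ)) * (Real.pi : ℂ)) - 1‖ < ‖α - β‖) ∨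
        (¬ 4 ∣ d ∧ (α * β) ^ r = -1 ∧
          ∀ j : ℕ, 1 ≤ j → j ≤ r - 1 →
            ‖1 - α ^ (2 * j + 1) * β ^ (2 * j - 1)‖ < ‖α - β‖)) := by
  have hr : 2 ≤ r := by omega
  have hr0 : 0 < r := by omega
  have hγ : ‖α * β‖ = 1 := by rw [norm_mul, hα, hβ, one_mul]
  have hodd : (∀ j : ℕ, 1 ≤ j → j ≤ r → ‖(α * β) ^ (2 * j - 1) - 1‖ < ‖α - β‖) →
      chordBound r < ‖α - β‖ := fun h =>
    chordBound_lt_of_forall_coset hr hγ hP fun k hk => by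
      have := h (k + 1) (by omega) (by omega)
      rwa [← norm_neg, show -((α * β) ^ (2 * (k + 1) - 1) - 1) = 1 - α * β * ((α * β) ^ 2) ^ k by
        rw [show 2 * (k + 1) - 1 = 2 * k + 1 by omega]; ring] at this
  constructor
  · intro h
    by_cases h4 : 4 ∣ d
    · have he : Even r := by rw [Nat.even_iff]; omega
      have h1 := hP.pow_eq_neg_one hr0 he
      exact Or.inl ⟨h4, h1, fun j hj _ => (norm_pow_sub_one_le_chordBound hr0 hγ
        (by rw [he.neg_pow, h1]) hj hP.pow_sq).trans_lt h⟩
    · have ho : Odd r := by rw [Nat.odd_iff]; omega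
      rcases sq_eq_one_iff.1 hP.pow_sq with h1 | h1
      · exact Or.inr (Or.inl ⟨h4, fun j hj _ => (norm_pow_sub_one_le_chordBound hr0 hγ
          (by rw [ho.neg_pow, h1]) hj hP.pow_sq).trans_lt h⟩)
      · exact Or.inr (Or.inr (Or.inl ⟨h4, h1, by rwa [norm_exp_sub_one_eq_chordBound hr0]⟩))
  · rintro (⟨-, -, h⟩ | ⟨-, h⟩ | ⟨-, -, h⟩ | ⟨-, -, h⟩)
    · exact hodd h
    · exact hodd h
    · rwa [norm_exp_sub_one_eq_chordBound hr0] at h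
    · refine chordBound_lt_of_forall_pow hr hα hβ hP fun k hk => ?_
      have := h (k + 1) (by omega) (by omega)
      rw [show 2 * (k + 1) - 1 = 2 * k + 1 by omega] at this
      convert this using 3
      ring

/-- A set of unimodular numbers with the closure properties of the spectrum of a product of two
symmetries that is also the product of `α I ⊕ β I` with a symmetry. -/
lemma chordBound_lt_of_spectrum {r : ℕ} {α β : ℂ} (hr : 2 ≤ r) (hα : ‖α‖ = 1) (hβ : ‖β‖ = 1)
    (hP : ConditionP r r α β) (S : Set ℂ) (hne : S.Nonempty) (hnorm : ∀ l ∈ S, ‖l‖ = 1)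
    (hinv : ∀ l ∈ S, l⁻¹ ∈ S)
    (hstep : ∀ l ∈ S, l ^ 2 = α ^ 2 ∨ l ^ 2 = β ^ 2 ∨
      (-(α * β) / l ∈ S ∧ ‖1 - α * β / l ^ 2‖ < ‖α - β‖)) :
    chordBound r < ‖α - β‖ := by
  by_cases hE : ∃ l ∈ S, l ^ 2 = α ^ 2 ∨ l ^ 2 = β ^ 2
  · obtain ⟨l, hl, hlα⟩ := hE
    wlog hlα' : l ^ 2 = α ^ 2 generalizing α β
    · rw [norm_sub_rev]
      exact this hβ hα hP.symm (fun m hm => by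
        rw [mul_comm β α, norm_sub_rev β α, or_left_comm]; exact hstep m hm) hlα.symm
        (hlα.resolve_left hlα')
    clear hlα
    have hl0 : l ≠ 0 := by have := hnorm l hl; rintro rfl; simp at this
    have hα0 : α ≠ 0 := by rintro rfl; simp at hα
    have hβ0 : β ≠ 0 := by rintro rfl; simp at hβ
    have key : ∀ k, k + 2 ≤ r → l * (-(α * β)) ^ k ∈ S →
        l * (-(α * β)) ^ (k + 1) ∈ S ∧ ‖1 - α ^ 2 * (α * β) ^ (2 * k + 1)‖ < ‖α - β‖ := by
      intro k hk hmem
      have hsq : (l * (-(α * β)) ^ k) ^ 2 = α ^ 2 * (α * β) ^ (2 * k) := by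
        rw [mul_pow, hlα', ← pow_mul, mul_comm k 2, pow_mul, neg_sq, ← pow_mul]
      have h0 : l * (-(α * β)) ^ k ≠ 0 := by
        exact mul_ne_zero hl0 (pow_ne_zero _ (neg_ne_zero.2 (mul_ne_zero hα0 hβ0)))
      -- Inverting and then applying `hstep` multiplies by `-(α * β)`. The two exits would give a
      -- relation forbidden by (P) with exponent sum `2 * k + 2 < 2 * r`, except that `k = 0` in the
      -- first exit means `α ^ 4 = 1`.
      rcases hstep _ (hinv _ hmem) with h | h | ⟨h1, h2⟩
      · exfalso
        rw [inv_pow, hsq, inv_eq_iff_eq_inv, ← mul_eq_one_iff_eq_inv₀ (pow_ne_zero _ hα0)] at h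
        rcases Nat.eq_zero_or_pos k with rfl | hk0
        · apply hP.pow_four_ne_one hr
          rw [← h]; ring
        · have := hP.le_of_sq (i := k + 2) (j := k) (by omega) hk0 (by rw [← h]; ring)
          omega
      · exfalso
        rw [inv_pow, hsq, inv_eq_iff_eq_inv, ← mul_eq_one_iff_eq_inv₀ (pow_ne_zero _ hβ0)] at h
        have := hP.le_of_sq (i := k + 1) (j := k + 1) (by omega) (by omega) (by rw [← h]; ring)
        omega
      · constructor
        · convert h1 using 1
          rw [div_inv_eq_mul]; ring
        · convert h2 using 3
          rw [inv_pow, hsq, div_inv_eq_mul]; ring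
    have hmem : ∀ k, k + 1 ≤ r → l * (-(α * β)) ^ k ∈ S := by
      intro k
      induction k with
      | zero => intro _; simpa using hl
      | succ k ih => intro hk; exact (key k hk (ih (by omega))).1
    exact chordBound_lt_of_forall_pow hr hα hβ hP fun k hk => (key k hk (hmem k (by omega))).2
  · push Not at hE
    obtain ⟨l, hl⟩ := hne
    have key : ∀ m ∈ S, -(α * β) * m ∈ S ∧ ‖1 - α * β * m ^ 2‖ < ‖α - β‖ := by
      intro m hm
      have hi := hinv m hm
      rcases hstep _ hi with h | h | ⟨h1, h2⟩
      · exact absurd h (hE _ hi).1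
      · exact absurd h (hE _ hi).2
      · rw [inv_pow, div_inv_eq_mul] at h2
        rw [div_inv_eq_mul] at h1
        exact ⟨h1, h2⟩
    have hmem : ∀ k : ℕ, (-(α * β)) ^ k * l ∈ S := by
      intro k
      induction k with
      | zero => simpa using hl
      | succ k ih => rw [pow_succ', mul_assoc]; exact (key _ ih).1
    refine chordBound_lt_of_forall_coset hr (z := α * β * l ^ 2) ?_ hP fun k _ => ?_
    · rw [norm_mul, norm_mul, norm_pow, hα, hβ, hnorm l hl]; norm_num
    · convert (key _ (hmem k)).2 using 3
      rw [mul_pow (_ ^ k), ← pow_mul _ k 2, mul_comm k 2, pow_mul, neg_sq]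
      ring

/-! ### Necessity: the spectrum of a product of two symmetries -/

/-- Here `p, q` stand for the squared masses of an eigenvector of `V J` on the two eigenspaces of
`V`, and `h` says that `⟨v, J v⟩` is real. The strict inequality comes from `‖p α + q β‖ ^ 2 = (p -
q) ^ 2 + p q ‖α + β‖ ^ 2`; when `α + β = 0` it is the equality case of the triangle inequality. -/
lemma norm_one_sub_lt_of_sesquilinear {α β l : ℂ} (hα : ‖α‖ = 1) (hβ : ‖β‖ = 1) (hl : ‖l‖ = 1)
    (hne : α ≠ β) {p q : ℝ} (hp : 0 ≤ p) (hq : 0 ≤ q) (hpq : 0 < p + q)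
    (h : l ^ 2 * (p * α⁻¹ + q * β⁻¹) = p * α + q * β) :
    l ^ 2 = α ^ 2 ∨ l ^ 2 = β ^ 2 ∨ ‖1 - α * β / l ^ 2‖ < ‖α - β‖ := by
  have hα0 : α ≠ 0 := by rintro rfl; simp at hα
  have hβ0 : β ≠ 0 := by rintro rfl; simp at hβ
  have hl0 : l ≠ 0 := by rintro rfl; simp at hl
  obtain rfl | hp := hp.eq_or_lt
  · right; left
    have hq0 : (q : ℂ) ≠ 0 := by
      have : q ≠ 0 := by linarith
      exact_mod_cast this
    field_simp at h
    simp only [Complex.ofReal_zero, zero_mul, zero_add] at h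
    have h2 : (q : ℂ) * α * (l ^ 2 - β ^ 2) = 0 := by linear_combination h
    simpa [hq0, hα0, sub_eq_zero] using h2
  obtain rfl | hq := hq.eq_or_lt
  · left
    have hp0 : (p : ℂ) ≠ 0 := by exact_mod_cast hp.ne'
    field_simp at h
    simp only [Complex.ofReal_zero, zero_mul, add_zero] at h
    have h2 : (p : ℂ) * β * (l ^ 2 - α ^ 2) = 0 := by linear_combination h
    simpa [hp0, hβ0, sub_eq_zero] using h2
  by_cases hab : α + β = 0
  · have hβα : β = -α := by linear_combination hab
    subst hβα
    by_cases hlα : l ^ 2 = α ^ 2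
    · exact Or.inl hlα
    right; right
    have hu : ‖α ^ 2 / l ^ 2‖ = 1 := by rw [norm_div, norm_pow, norm_pow, hα, hl]; norm_num
    have h2 : ‖α - -α‖ = 2 := by rw [sub_neg_eq_add, ← two_mul, norm_mul, hα]; norm_num
    have h3 : 1 - α * -α / l ^ 2 = 1 + α ^ 2 / l ^ 2 := by ring
    rw [h2, h3]
    have hle : ‖1 + α ^ 2 / l ^ 2‖ ≤ 2 := by
      have := norm_add_le (1 : ℂ) (α ^ 2 / l ^ 2)
      rw [hu, norm_one] at this; linarith
    refine lt_of_le_of_ne hle fun heq => hlα ?_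
    have hray : SameRay ℝ (1 : ℂ) (α ^ 2 / l ^ 2) := by
      rw [sameRay_iff_norm_add, heq, hu]; norm_num
    have := (sameRay_iff_of_norm_eq (by rw [hu, norm_one])).1 hray
    rw [eq_div_iff (pow_ne_zero _ hl0), one_mul] at this
    exact this
  · right; right
    have hconj : ‖(p : ℂ) * α⁻¹ + q * β⁻¹‖ = ‖(p : ℂ) * α + q * β‖ := by
      have := congrArg norm h
      rwa [norm_mul, norm_pow, hl, one_pow, one_mul] at this
    have hid : (l ^ 2 - α * β) * (p * α⁻¹ + q * β⁻¹) = ((p - q : ℝ) : ℂ) * (α - β) := by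
      rw [sub_mul, h]; push_cast; field_simp; ring
    have hn := congrArg norm hid
    rw [norm_mul, norm_mul, hconj, Complex.norm_real, Real.norm_eq_abs] at hn
    have hsq : ‖(p : ℂ) * α + q * β‖ ^ 2 = (p - q) ^ 2 + p * q * ‖α + β‖ ^ 2 := by
      have h1 : ‖α‖ ^ 2 = 1 := by rw [hα]; norm_num
      have h2 : ‖β‖ ^ 2 = 1 := by rw [hβ]; norm_num
      rw [Complex.sq_norm, Complex.normSq_apply] at h1 h2 ⊢
      rw [Complex.sq_norm, Complex.normSq_apply]
      simp only [Complex.add_re, Complex.add_im, Complex.mul_re, Complex.mul_im,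
        Complex.ofReal_re, Complex.ofReal_im]
      linear_combination (p ^ 2 - p * q) * h1 + (q ^ 2 - p * q) * h2
    have habp : 0 < ‖α + β‖ := norm_pos_iff.2 hab
    have hlt : |p - q| < ‖(p : ℂ) * α + q * β‖ := by
      apply lt_of_pow_lt_pow_left₀ 2 (norm_nonneg _)
      rw [sq_abs, hsq]
      have : 0 < p * q * ‖α + β‖ ^ 2 := by positivity
      linarith
    have hpos : 0 < ‖α - β‖ := norm_pos_iff.2 (sub_ne_zero.2 hne)
    have heq : ‖1 - α * β / l ^ 2‖ = ‖l ^ 2 - α * β‖ := by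
      rw [show 1 - α * β / l ^ 2 = (l ^ 2 - α * β) / l ^ 2 by field_simp, norm_div, norm_pow, hl]
      simp
    rw [heq]
    by_contra! hcon
    have hpos' := (abs_nonneg (p - q)).trans_lt hlt
    have := mul_le_mul_of_nonneg_right hcon hpos'.le
    rw [hn, mul_comm] at this
    nlinarith

/-! ### Eigenvectors of a product of two symmetries and of `V J` -/

open Matrix

lemma IsSymmetryMatrix.mulVec_mulVec {n : Type*} [Fintype n] [DecidableEq n] {J : Matrix n n ℂ}
    (hJ : IsSymmetryMatrix J) (v : n → ℂ) : J *ᵥ (J *ᵥ v) = v := by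
  rw [Matrix.mulVec_mulVec, hJ.2, Matrix.one_mulVec]

lemma IsSymmetryMatrix.star_mulVec_dotProduct {n : Type*} [Fintype n] [DecidableEq n]
    {J : Matrix n n ℂ} (hJ : IsSymmetryMatrix J) (v w : n → ℂ) :
    star (J *ᵥ v) ⬝ᵥ w = star v ⬝ᵥ (J *ᵥ w) := by
  rw [Matrix.star_mulVec, hJ.1.eq, Matrix.dotProduct_mulVec]

lemma IsSymmetryMatrix.star_mulVec_dotProduct_mulVec {n : Type*} [Fintype n] [DecidableEq n]
    {J : Matrix n n ℂ} (hJ : IsSymmetryMatrix J) (v : n → ℂ) :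
    star (J *ᵥ v) ⬝ᵥ (J *ᵥ v) = star v ⬝ᵥ v := by
  rw [hJ.star_mulVec_dotProduct, hJ.mulVec_mulVec]

lemma norm_eq_one_of_mul_mulVec_eq_smul {n : Type*} [Fintype n] [DecidableEq n]
    {J K : Matrix n n ℂ} (hJ : IsSymmetryMatrix J) (hK : IsSymmetryMatrix K) {v : n → ℂ}
    (hv : v ≠ 0) {l : ℂ} (h : (J * K) *ᵥ v = l • v) : ‖l‖ = 1 := by
  have h1 : star ((J * K) *ᵥ v) ⬝ᵥ ((J * K) *ᵥ v) = star v ⬝ᵥ v := by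
    rw [← Matrix.mulVec_mulVec, hJ.star_mulVec_dotProduct_mulVec, hK.star_mulVec_dotProduct_mulVec]
  have hv0 : star v ⬝ᵥ v ≠ 0 := by
    open ComplexOrder in rwa [Ne, dotProduct_star_self_eq_zero]
  rw [h, star_smul, smul_dotProduct, dotProduct_smul, smul_smul, smul_eq_mul] at h1
  have h2 : star l * l = 1 := mul_right_cancel₀ hv0 (h1.trans (one_mul _).symm)
  have h3 : ‖l‖ * ‖l‖ = 1 := by
    have := congrArg norm h2
    simpa using this
  nlinarith [norm_nonneg l]

lemma mul_mulVec_mulVec_eq_inv_smul {n : Type*} [Fintype n] [DecidableEq n]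
    {J K : Matrix n n ℂ} (hJ : IsSymmetryMatrix J) (hK : IsSymmetryMatrix K) {v : n → ℂ}
    {l : ℂ} (hl : l ≠ 0) (h : (J * K) *ᵥ v = l • v) : (J * K) *ᵥ (J *ᵥ v) = l⁻¹ • (J *ᵥ v) := by
  have h1 : v = l • (K *ᵥ (J *ᵥ v)) := by
    rw [← Matrix.mulVec_smul, ← Matrix.mulVec_smul, ← h, ← Matrix.mulVec_mulVec, hJ.mulVec_mulVec,
      hK.mulVec_mulVec]
  have h2 : K *ᵥ (J *ᵥ v) = l⁻¹ • v := by
    rw [eq_inv_smul_iff₀ hl]; exact h1.symm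
  rw [← Matrix.mulVec_mulVec, h2, Matrix.mulVec_smul]

lemma twoEigMatrix_mulVec_inl {r s : ℕ} (α β : ℂ) (v : Fin r ⊕ Fin s → ℂ) (i : Fin r) :
    (twoEigMatrix r s α β *ᵥ v) (Sum.inl i) = α * v (Sum.inl i) := by
  simp [twoEigMatrix, Matrix.fromBlocks_mulVec, Matrix.smul_mulVec]

lemma twoEigMatrix_mulVec_inr {r s : ℕ} (α β : ℂ) (v : Fin r ⊕ Fin s → ℂ) (i : Fin s) :
    (twoEigMatrix r s α β *ᵥ v) (Sum.inr i) = β * v (Sum.inr i) := by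
  simp [twoEigMatrix, Matrix.fromBlocks_mulVec, Matrix.smul_mulVec]

lemma eigenvalue_twoEigMatrix_mul {r s : ℕ} {α β : ℂ} (hα : ‖α‖ = 1) (hβ : ‖β‖ = 1)
    (hne : α ≠ β) {J : Matrix (Fin r ⊕ Fin s) (Fin r ⊕ Fin s) ℂ} (hJ : IsSymmetryMatrix J)
    {v : Fin r ⊕ Fin s → ℂ} (hv : v ≠ 0) {l : ℂ} (hl : ‖l‖ = 1)
    (h : (twoEigMatrix r s α β * J) *ᵥ v = l • v) :
    l ^ 2 = α ^ 2 ∨ l ^ 2 = β ^ 2 ∨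
      ((∃ w ≠ 0, (twoEigMatrix r s α β * J) *ᵥ w = (-(α * β) / l) • w) ∧
        ‖1 - α * β / l ^ 2‖ < ‖α - β‖) := by
  have hα0 : α ≠ 0 := by rintro rfl; simp at hα
  have hβ0 : β ≠ 0 := by rintro rfl; simp at hβ
  have hl0 : l ≠ 0 := by rintro rfl; simp at hl
  rw [← Matrix.mulVec_mulVec] at h
  have hinl : ∀ i, (J *ᵥ v) (Sum.inl i) = l * α⁻¹ * v (Sum.inl i) := by
    intro i
    have := congrFun h (Sum.inl i)
    rw [twoEigMatrix_mulVec_inl, Pi.smul_apply, smul_eq_mul] at this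
    field_simp
    linear_combination this
  have hinr : ∀ i, (J *ᵥ v) (Sum.inr i) = l * β⁻¹ * v (Sum.inr i) := by
    intro i
    have := congrFun h (Sum.inr i)
    rw [twoEigMatrix_mulVec_inr, Pi.smul_apply, smul_eq_mul] at this
    field_simp
    linear_combination this
  by_cases hlα : l ^ 2 = α ^ 2
  · exact Or.inl hlα
  by_cases hlβ : l ^ 2 = β ^ 2
  · exact Or.inr (Or.inl hlβ)
  refine Or.inr (Or.inr ⟨?_, ?_⟩)
  · by_cases hlm : l = -(α * β) / l
    · exact ⟨v, hv, by rw [← hlm, ← Matrix.mulVec_mulVec, h]⟩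
    have hd0 : l - -(α * β) / l ≠ 0 := sub_ne_zero.2 hlm
    -- With `l' = -(α * β) / l`, the relation `(V - α)(V - β) = 0` gives `V J (J v) = (α + β) v + l'
    -- J v`. So `V J` is triangular on the span of `v` and `J v`, and this is its eigenvector for
    -- `l'`. It vanishes only if `J v = ± v`, which forces `l ^ 2` to be `α ^ 2` or `β ^ 2`.
    refine ⟨(l - -(α * β) / l) • (J *ᵥ v) - (α + β) • v, ?_, ?_⟩
    · intro h0
      have h1 : J *ᵥ v = ((α + β) / (l - -(α * β) / l)) • v := by
        rw [sub_eq_zero] at h0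
        rw [div_eq_inv_mul, mul_smul, ← h0, smul_smul, inv_mul_cancel₀ hd0, one_smul]
      set t := (α + β) / (l - -(α * β) / l)
      have ht : t ^ 2 = 1 := by
        have h2 := hJ.mulVec_mulVec v
        rw [h1, Matrix.mulVec_smul, h1, smul_smul] at h2
        obtain ⟨i, hi⟩ := Function.ne_iff.1 hv
        have h3 := congrFun h2 i
        rw [Pi.smul_apply, smul_eq_mul] at h3
        rw [sq]
        exact mul_right_cancel₀ hi (h3.trans (one_mul _).symm)
      obtain ⟨i | i, hi⟩ := Function.ne_iff.1 hv
      · apply hlα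
        have h3 := hinl i
        rw [h1, Pi.smul_apply, smul_eq_mul] at h3
        have h4 := mul_right_cancel₀ hi h3
        rw [h4] at ht
        field_simp at ht
        exact ht
      · apply hlβ
        have h3 := hinr i
        rw [h1, Pi.smul_apply, smul_eq_mul] at h3
        have h4 := mul_right_cancel₀ hi h3
        rw [h4] at ht
        field_simp at ht
        exact ht
    · rw [← Matrix.mulVec_mulVec, Matrix.mulVec_sub, Matrix.mulVec_smul, Matrix.mulVec_smul,
        hJ.mulVec_mulVec, Matrix.mulVec_sub, Matrix.mulVec_smul, Matrix.mulVec_smul, h]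
      ext (i | i)
      · simp only [Pi.sub_apply, Pi.smul_apply, smul_eq_mul, twoEigMatrix_mulVec_inl, hinl]
        field_simp
        ring
      · simp only [Pi.sub_apply, Pi.smul_apply, smul_eq_mul, twoEigMatrix_mulVec_inr, hinr]
        field_simp
        ring
  · have hx : star (star v ⬝ᵥ (J *ᵥ v)) = star v ⬝ᵥ (J *ᵥ v) := by
      conv_rhs => rw [← hJ.star_mulVec_dotProduct]
      rw [Matrix.star_dotProduct, star_star]
    set p : ℝ := ∑ i, ‖v (Sum.inl i)‖ ^ 2 with hp
    set q : ℝ := ∑ i, ‖v (Sum.inr i)‖ ^ 2 with hq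
    have hxe : star v ⬝ᵥ (J *ᵥ v) = l * (p * α⁻¹ + q * β⁻¹) := by
      simp only [dotProduct, Fintype.sum_sum_type, Pi.star_apply, hinl, hinr, hp, hq]
      push_cast
      rw [Finset.sum_mul, Finset.sum_mul, mul_add, Finset.mul_sum, Finset.mul_sum]
      congr 1 <;>
      · refine Finset.sum_congr rfl fun i _ => ?_
        rw [← Complex.conj_mul', ← starRingEnd_apply]
        ring
    have hp0 : 0 ≤ p := Finset.sum_nonneg fun i _ => by positivity
    have hq0 : 0 ≤ q := Finset.sum_nonneg fun i _ => by positivity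
    have hpq : 0 < p + q := by
      obtain ⟨i | i, hi⟩ := Function.ne_iff.1 hv
      · have : 0 < p := Finset.sum_pos' (fun i _ => by positivity)
          ⟨i, Finset.mem_univ _, by have := norm_pos_iff.2 hi; positivity⟩
        linarith
      · have : 0 < q := Finset.sum_pos' (fun i _ => by positivity)
          ⟨i, Finset.mem_univ _, by have := norm_pos_iff.2 hi; positivity⟩
        linarith
    rw [hxe] at hx
    have hfin : l ^ 2 * (p * α⁻¹ + q * β⁻¹) = p * α + q * β := by
      simp only [star_mul', star_add, star_inv₀, star_eq_inv_of_norm_eq_one hα,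
        star_eq_inv_of_norm_eq_one hβ, star_eq_inv_of_norm_eq_one hl, inv_inv] at hx
      have hpr : star (p : ℂ) = p := Complex.conj_ofReal p
      have hqr : star (q : ℂ) = q := Complex.conj_ofReal q
      rw [hpr, hqr] at hx
      field_simp at hx ⊢
      linear_combination -hx
    rcases norm_one_sub_lt_of_sesquilinear hα hβ hl hne hp0 hq0 hpq hfin with h1 | h1 | h1
    · exact absurd h1 hlα
    · exact absurd h1 hlβ
    · exact h1

lemma chordBound_lt_of_mem_symProd {r : ℕ} (hr : 2 ≤ r) {α β : ℂ} (hα : ‖α‖ = 1) (hβ : ‖β‖ = 1)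
    (hne : α ≠ β) (hP : ConditionP r r α β) (h : twoEigMatrix r r α β ∈ SymProd 3 (Fin r ⊕ Fin r)) :
    chordBound r < ‖α - β‖ := by
  obtain ⟨J, hJ, hV⟩ := h
  have hU : twoEigMatrix r r α β * J 2 = J 0 * J 1 := by
    rw [hV]
    simp [List.ofFn_succ, mul_assoc, (hJ 2).2]
  refine chordBound_lt_of_spectrum hr hα hβ hP {l | ∃ v ≠ 0, (J 0 * J 1) *ᵥ v = l • v} ?_ ?_ ?_ ?_
  · have : Nonempty (Fin r) := ⟨⟨0, by omega⟩⟩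
    obtain ⟨l, hl⟩ := Module.End.exists_eigenvalue (Matrix.toLin' (J 0 * J 1))
    obtain ⟨v, hv⟩ := hl.exists_hasEigenvector
    exact ⟨l, v, hv.2, by simpa using hv.apply_eq_smul⟩
  · rintro l ⟨v, hv, h⟩
    exact norm_eq_one_of_mul_mulVec_eq_smul (hJ 0) (hJ 1) hv h
  · rintro l ⟨v, hv, h⟩
    have hl := norm_eq_one_of_mul_mulVec_eq_smul (hJ 0) (hJ 1) hv h
    refine ⟨J 0 *ᵥ v, fun h0 => hv ?_, mul_mulVec_mulVec_eq_inv_smul (hJ 0) (hJ 1) ?_ h⟩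
    · rw [← (hJ 0).mulVec_mulVec v, h0, Matrix.mulVec_zero]
    · rintro rfl; simp at hl
  · rintro l ⟨v, hv, h⟩
    have hl := norm_eq_one_of_mul_mulVec_eq_smul (hJ 0) (hJ 1) hv h
    rw [← hU] at h
    simp only [← hU]
    exact eigenvalue_twoEigMatrix_mul hα hβ hne (hJ 2) hv hl h

/-! ### Sufficiency: an explicit factorization -/

/-- The real symmetry `!![b, y; y, a]` turns the diagonal matrix with entries `l, m` into a matrix
that the unitary `!![u, -conj w; w, u]` diagonalizes, with eigenvalues `α` and `β`. -/
def BlockFactorization (α β l m : ℂ) : Prop :=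
  ∃ (a b y u : ℝ) (w : ℂ), b ^ 2 + y ^ 2 = 1 ∧ a ^ 2 + y ^ 2 = 1 ∧ y * (a + b) = 0 ∧
    (u : ℂ) ^ 2 + w * star w = 1 ∧ α * u ^ 2 + β * (w * star w) = l * b ∧
    (α - β) * (u * star w) = l * y ∧ (α - β) * (u * w) = m * y ∧
    α * (w * star w) + β * u ^ 2 = m * a

/-- The hypothesis says that the Hermitian matrix with diagonal `p, 1 - p` and off-diagonal entry
`z` is a rank-one projection; `(u, w)` is a unit vector spanning its range, up to conjugation. -/
lemma exists_rank_one_factor {p : ℝ} {z : ℂ} (h : (p : ℂ) * (1 - p) = z * star z) :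
    ∃ (u : ℝ) (w : ℂ), (u : ℂ) ^ 2 = p ∧ w * star w = 1 - p ∧ u * w = star z := by
  have hn : p * (1 - p) = ‖z‖ ^ 2 := by
    have h1 : z * star z = ((‖z‖ ^ 2 : ℝ) : ℂ) := by
      rw [← starRingEnd_apply, Complex.mul_conj']; push_cast; rfl
    rw [h1] at h
    exact_mod_cast h
  have hp : 0 ≤ p := by nlinarith [sq_nonneg ‖z‖, sq_nonneg p]
  have hu : ((√p : ℝ) : ℂ) ^ 2 = p := by exact_mod_cast Real.sq_sqrt hp
  obtain rfl | hp := hp.eq_or_lt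
  · have hz : z = 0 := by simpa using hn.symm
    exact ⟨0, 1, by simp, by simp, by simp [hz]⟩
  · have hu0 : ((√p : ℝ) : ℂ) ≠ 0 := by exact_mod_cast (Real.sqrt_pos.2 hp).ne'
    refine ⟨√p, star z / √p, hu, ?_, mul_div_cancel₀ _ hu0⟩
    have hp0 : (p : ℂ) ≠ 0 := by exact_mod_cast hp.ne'
    have hur : star ((√p : ℝ) : ℂ) = (√p : ℝ) := Complex.conj_ofReal _
    rw [star_div₀, star_star, hur, div_mul_div_comm, ← sq, hu, mul_comm, ← h]
    field_simp

/-- The symmetry has diagonal `x, -x`. Its determinant `-1` makes the product have determinant `α *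
β`, and matching the trace forces `x = (α + β) / (l - m)`. By the parallelogram law the hypothesis
becomes `‖α + β‖ < ‖l - m‖`, so `|x| ≤ 1`. -/
lemma blockFactorization_of_norm_lt {α β l m : ℂ} (hα : ‖α‖ = 1) (hβ : ‖β‖ = 1) (hl : ‖l‖ = 1)
    (hm : ‖m‖ = 1) (hlm : l * m = -(α * β)) (h : ‖l + m‖ < ‖α - β‖) :
    BlockFactorization α β l m := by
  have hα0 : α ≠ 0 := by rintro rfl; simp at hα
  have hβ0 : β ≠ 0 := by rintro rfl; simp at hβ
  have hl0 : l ≠ 0 := by rintro rfl; simp at hl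
  have hm0 : m ≠ 0 := by rintro rfl; simp at hm
  have hne : α - β ≠ 0 := norm_pos_iff.1 ((norm_nonneg _).trans_lt h)
  have hsum : ‖α + β‖ < ‖l - m‖ := by
    have h1 := parallelogram_law_with_norm ℝ α β
    have h2 := parallelogram_law_with_norm ℝ l m
    rw [hα, hβ] at h1
    rw [hl, hm] at h2
    have h3 := norm_nonneg (l + m)
    have h4 := norm_nonneg (α + β)
    have h5 := norm_nonneg (l - m)
    nlinarith
  have hd : l - m ≠ 0 := norm_pos_iff.1 ((norm_nonneg _).trans_lt hsum)
  have hsα := star_eq_inv_of_norm_eq_one hα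
  have hsβ := star_eq_inv_of_norm_eq_one hβ
  have hsl := star_eq_inv_of_norm_eq_one hl
  have hsm := star_eq_inv_of_norm_eq_one hm
  obtain ⟨x, hx⟩ : ∃ x : ℝ, (x : ℂ) = (α + β) / (l - m) := by
    have hd' : l⁻¹ - m⁻¹ ≠ 0 := by
      rw [sub_ne_zero]; intro he; exact hd (sub_eq_zero.2 (inv_injective he))
    have : (starRingEnd ℂ) ((α + β) / (l - m)) = (α + β) / (l - m) := by
      rw [starRingEnd_apply, star_div₀, star_add, star_sub, hsα, hsβ, hsl, hsm,
        div_eq_div_iff hd' hd]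
      field_simp
      linear_combination (α + β) * (l - m) * hlm
    obtain ⟨x, hx⟩ := Complex.conj_eq_iff_real.1 this
    exact ⟨x, hx.symm⟩
  have hxd : x * (l - m) = α + β := by rw [hx, div_mul_cancel₀ _ hd]
  have hx1 : x ^ 2 ≤ 1 := by
    have h1 : |x| ≤ 1 := by
      have h2 : ‖(x : ℂ)‖ = |x| := by rw [Complex.norm_real, Real.norm_eq_abs]
      rw [← h2, hx, norm_div]
      exact div_le_one_of_le₀ hsum.le (norm_nonneg _)
    rwa [sq_le_one_iff_abs_le_one]
  set y : ℝ := √(1 - x ^ 2) with hy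
  have hxy : x ^ 2 + y ^ 2 = 1 := by rw [hy, Real.sq_sqrt (by linarith)]; ring
  have hxyC : (x : ℂ) ^ 2 + (y : ℂ) ^ 2 = 1 := by exact_mod_cast hxy
  have hsx : star (x : ℂ) = x := Complex.conj_ofReal x
  have hsy : star (y : ℂ) = y := Complex.conj_ofReal y
  have hne' : α⁻¹ - β⁻¹ ≠ 0 := by
    rw [sub_ne_zero]; intro he; exact hne (sub_eq_zero.2 (inv_injective he))
  -- `p` and `l * y / (α - β)` are entries of the spectral projection for `α` of the product.
  obtain ⟨p, hp⟩ : ∃ p : ℝ, (p : ℂ) = (l * x - β) / (α - β) := by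
    have : (starRingEnd ℂ) ((l * x - β) / (α - β)) = (l * x - β) / (α - β) := by
      rw [starRingEnd_apply, star_div₀, star_sub, star_sub, star_mul', hsα, hsβ, hsl, hsx,
        div_eq_div_iff hne' hne]
      field_simp
      linear_combination (α - β) * l * hxd + (α - β) * x * hlm
    obtain ⟨p, hp⟩ := Complex.conj_eq_iff_real.1 this
    exact ⟨p, hp.symm⟩
  have hpd : p * (α - β) = l * x - β := by rw [hp, div_mul_cancel₀ _ hne]
  have hsz : star (l * y / (α - β)) = m * y / (α - β) := by
    rw [star_div₀, star_sub, star_mul', hsα, hsβ, hsl, hsy, div_eq_div_iff hne' hne]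
    field_simp
    linear_combination (α - β) * y * hlm
  obtain ⟨u, w, hu, hw, huw⟩ := exists_rank_one_factor (p := p) (z := l * y / (α - β)) (by
    rw [hsz, div_mul_div_comm, eq_div_iff (mul_ne_zero hne hne)]
    linear_combination (α - β - p * (α - β) - (l * x - β)) * hpd - l * x * hxd - l * m * hxyC - hlm)
  have hsu : star (u : ℂ) = u := Complex.conj_ofReal u
  refine ⟨-x, x, y, u, w, hxy, by rw [neg_sq, hxy], by ring, by rw [hu, hw]; ring, ?_, ?_, ?_, ?_⟩
  · rw [hu, hw]; linear_combination hpd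
  · have : u * star w = l * y / (α - β) := by
      rw [← star_star (l * y / (α - β)), ← huw, star_mul', hsu]
    rw [this, mul_div_cancel₀ _ hne]
  · rw [huw, hsz, mul_div_cancel₀ _ hne]
  · rw [hu, hw]; push_cast; linear_combination -hpd - hxd

/-! ### Assembling the 2×2 blocks into three symmetries -/

lemma isSymmetryMatrix_fromBlocks {n : Type*} [Fintype n] [DecidableEq n] {X : Matrix n n ℂ}
    (hX : X * Xᴴ = 1) : IsSymmetryMatrix (Matrix.fromBlocks 0 X Xᴴ 0) := by
  constructor
  · rw [Matrix.IsHermitian, Matrix.fromBlocks_conjTranspose]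
    simp
  · rw [Matrix.fromBlocks_multiply]
    simp [hX, mul_eq_one_comm.1 hX]

lemma IsSymmetryMatrix.conj {n : Type*} [Fintype n] [DecidableEq n] {J W : Matrix n n ℂ}
    (hJ : IsSymmetryMatrix J) (hW : W * Wᴴ = 1) : IsSymmetryMatrix (Wᴴ * J * W) := by
  constructor
  · rw [Matrix.IsHermitian, Matrix.conjTranspose_mul, Matrix.conjTranspose_mul,
      Matrix.conjTranspose_conjTranspose, hJ.1.eq, mul_assoc]
  · calc Wᴴ * J * W * (Wᴴ * J * W) = Wᴴ * J * (W * Wᴴ) * J * W := by simp only [mul_assoc]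
      _ = Wᴴ * (J * J) * W := by rw [hW, mul_one]; simp only [mul_assoc]
      _ = 1 := by rw [hJ.2, mul_one, mul_eq_one_comm.1 hW]

lemma mem_symProd_three {n : Type*} [Fintype n] [DecidableEq n] {V J₁ J₂ J₃ W : Matrix n n ℂ}
    (h₁ : IsSymmetryMatrix J₁) (h₂ : IsSymmetryMatrix J₂) (h₃ : IsSymmetryMatrix J₃)
    (hW : W * Wᴴ = 1) (hV : W * V = J₁ * J₂ * J₃ * W) : V ∈ SymProd 3 n := by
  have hW' := mul_eq_one_comm.1 hW
  refine ⟨![Wᴴ * J₁ * W, Wᴴ * J₂ * W, Wᴴ * J₃ * W], ?_, ?_⟩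
  · intro i
    fin_cases i
    · exact h₁.conj hW
    · exact h₂.conj hW
    · exact h₃.conj hW
  · have h : V = Wᴴ * (J₁ * J₂ * J₃ * W) := by rw [← hV, ← mul_assoc, hW', one_mul]
    have h' : V = Wᴴ * J₁ * (W * Wᴴ) * J₂ * (W * Wᴴ) * J₃ * W := by
      rw [h, hW, mul_one, mul_one]; simp only [mul_assoc]
    rw [h']
    simp [List.ofFn_succ, mul_assoc]

lemma permMatrix_mul_diagonal_mul_conjTranspose {n : Type*} [Fintype n] [DecidableEq n]
    (σ : Equiv.Perm n) (f : n → ℂ) :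
    σ.permMatrix ℂ * Matrix.diagonal f * (σ.permMatrix ℂ)ᴴ = Matrix.diagonal (f ∘ σ) := by
  rw [Matrix.conjTranspose_permMatrix, Equiv.Perm.permMatrix, Equiv.Perm.permMatrix,
    PEquiv.toMatrix_toPEquiv_mul, PEquiv.mul_toMatrix_toPEquiv]
  ext i j
  have : (Equiv.symm σ⁻¹) j = σ j := rfl
  simp [Matrix.diagonal_apply, this]

lemma twoEigMatrix_mem_symProd_of_blocks {r : ℕ} {α β : ℂ} (l : Fin r → ℂ)
    (σ : Equiv.Perm (Fin r)) (hl : ∀ k, ‖l k‖ = 1)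
    (h : ∀ k, BlockFactorization α β (l (σ k)) (l k)⁻¹) :
    twoEigMatrix r r α β ∈ SymProd 3 (Fin r ⊕ Fin r) := by
  choose a b y u w hby hay hab huw h11 h12 h21 h22 using h
  let P : Matrix (Fin r) (Fin r) ℂ := σ.permMatrix ℂ
  have hP : P * Pᴴ = 1 := by
    have := permMatrix_mul_diagonal_mul_conjTranspose σ (fun _ => 1)
    rw [Matrix.diagonal_one, mul_one] at this
    rw [this]
    exact Matrix.diagonal_one
  have hP' : Pᴴ * P = 1 := mul_eq_one_comm.1 hP
  let D : Matrix (Fin r) (Fin r) ℂ := Matrix.diagonal fun k => (l k)⁻¹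
  have hDs : Dᴴ = Matrix.diagonal l := by
    simp only [D, Matrix.diagonal_conjTranspose]
    congr 1
    ext k
    simp [← star_eq_inv_of_norm_eq_one (hl k)]
  have hD : D * Dᴴ = 1 := by
    rw [hDs]
    simp only [D, Matrix.diagonal_mul_diagonal]
    rw [← Matrix.diagonal_one]
    congr 1
    ext k
    have : l k ≠ 0 := by have := hl k; intro h0; simp [h0] at this
    exact inv_mul_cancel₀ this
  have hX : (P * D) * (P * D)ᴴ = 1 := by
    rw [Matrix.conjTranspose_mul, mul_assoc, ← mul_assoc D, hD, one_mul, hP]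
  have hprod : Matrix.fromBlocks 0 P Pᴴ 0 * Matrix.fromBlocks 0 (P * D) (P * D)ᴴ 0
      = Matrix.fromBlocks (Matrix.diagonal (l ∘ σ)) 0 0 D := by
    rw [Matrix.fromBlocks_multiply, Matrix.conjTranspose_mul, hDs, ← mul_assoc P,
      permMatrix_mul_diagonal_mul_conjTranspose, ← mul_assoc Pᴴ, hP']
    simp
  let R : (Fin r → ℝ) → Matrix (Fin r) (Fin r) ℂ := fun f => Matrix.diagonal fun k => (f k : ℂ)
  have hRs : ∀ f, (R f)ᴴ = R f := fun f => by
    simp only [R, Matrix.diagonal_conjTranspose]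
    congr 1
    ext k
    exact Complex.conj_ofReal _
  have hJ₃ : IsSymmetryMatrix (Matrix.fromBlocks (R b) (R y) (R y) (R a)) := by
    constructor
    · rw [Matrix.IsHermitian, Matrix.fromBlocks_conjTranspose, hRs, hRs, hRs]
    · simp only [R, Matrix.fromBlocks_multiply, Matrix.diagonal_mul_diagonal,
        Matrix.diagonal_add]
      rw [← Matrix.fromBlocks_one]
      congr 1
      · rw [← Matrix.diagonal_one]; congr 1; ext k
        have := hby k
        norm_cast
        linarith
      · rw [← Matrix.diagonal_zero]; congr 1; ext k
        have := hab k
        norm_cast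
        linarith
      · rw [← Matrix.diagonal_zero]; congr 1; ext k
        have := hab k
        norm_cast
        linarith
      · rw [← Matrix.diagonal_one]; congr 1; ext k
        have := hay k
        norm_cast
        linarith
  refine mem_symProd_three (isSymmetryMatrix_fromBlocks hP) (isSymmetryMatrix_fromBlocks hX) hJ₃
    (W := Matrix.fromBlocks (R u) (Matrix.diagonal fun k => -star (w k)) (Matrix.diagonal w) (R u))
    ?_ ?_
  · rw [Matrix.fromBlocks_conjTranspose, hRs]
    simp only [R, Matrix.diagonal_conjTranspose, Matrix.fromBlocks_multiply,
      Matrix.diagonal_mul_diagonal, Matrix.diagonal_add]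
    rw [← Matrix.fromBlocks_one]
    congr 1
    · rw [← Matrix.diagonal_one]; congr 1; ext k
      simp only [Pi.star_apply, star_neg, star_star]
      linear_combination huw k
    · rw [← Matrix.diagonal_zero]; congr 1; ext k
      simp only [Pi.star_apply]
      ring
    · rw [← Matrix.diagonal_zero]; congr 1; ext k
      simp only [Pi.star_apply, star_neg, star_star]
      ring
    · rw [← Matrix.diagonal_one]; congr 1; ext k
      simp only [Pi.star_apply]
      linear_combination huw k
  · rw [hprod]
    have hs : ∀ c : ℂ, c • (1 : Matrix (Fin r) (Fin r) ℂ) = Matrix.diagonal fun _ => c := fun c => by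
      rw [Matrix.smul_one_eq_diagonal]
    simp only [twoEigMatrix, hs, R, D, Matrix.fromBlocks_multiply, Matrix.diagonal_mul_diagonal,
      Matrix.diagonal_add, Matrix.mul_zero, Matrix.zero_mul, add_zero, zero_add, Function.comp_apply]
    congr 1
    · congr 1; ext k
      linear_combination u k * h11 k + w k * h12 k - α * u k * huw k
    · congr 1; ext k
      linear_combination -star (w k) * h11 k + u k * h12 k + β * star (w k) * huw k
    · congr 1; ext k
      linear_combination u k * h21 k + w k * h22 k - α * w k * huw k
    · congr 1; ext k
      linear_combination -star (w k) * h21 k + u k * h22 k - β * u k * huw k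

lemma blockFactorization_of_sq_eq {α β m : ℂ} (h : m ^ 2 = β ^ 2) : BlockFactorization α β α m := by
  rcases sq_eq_sq_iff_eq_or_eq_neg.1 h with rfl | rfl
  · exact ⟨1, 1, 0, 1, 0, by simp⟩
  · exact ⟨-1, 1, 0, 1, 0, by simp⟩

lemma mem_symProd_of_chordBound_lt {r : ℕ} (hr : 2 ≤ r) {α β : ℂ} (hα : ‖α‖ = 1) (hβ : ‖β‖ = 1)
    (hP : ConditionP r r α β) (h : chordBound r < ‖α - β‖) :
    twoEigMatrix r r α β ∈ SymProd 3 (Fin r ⊕ Fin r) := by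
  obtain ⟨n, rfl⟩ : ∃ n, r = n + 1 := ⟨r - 1, by omega⟩
  have hα0 : α ≠ 0 := by rintro rfl; simp at hα
  have hβ0 : β ≠ 0 := by rintro rfl; simp at hβ
  have hnorm : ∀ k : ℕ, ‖(-(α * β)) ^ k * α‖ = 1 := fun k => by
    rw [norm_mul, norm_pow, norm_neg, norm_mul, hα, hβ]; simp
  -- Consecutive terms satisfy `l (k + 1) * (l k)⁻¹ = -(α * β)`, the determinant each block needs.
  -- The wrap-around pair is `α` and `(l (r - 1))⁻¹`, whose square is `β ^ 2` by (P), so a diagonal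
  -- symmetry suffices there.
  refine twoEigMatrix_mem_symProd_of_blocks (fun k => (-(α * β)) ^ (k : ℕ) * α) (finRotate (n + 1))
    (fun k => hnorm k) fun k => ?_
  by_cases hk : (k : ℕ) = n
  · have hlast : k = Fin.last n := Fin.ext hk
    subst hlast
    rw [finRotate_last]
    simp only [Fin.val_zero, pow_zero, one_mul, Fin.val_last]
    apply blockFactorization_of_sq_eq
    have hs : ((α * β) ^ n * α) ^ 2 * β ^ 2 = 1 := by rw [← hP.pow_sq]; ring
    rw [inv_pow, mul_pow, ← pow_mul, mul_comm n 2, pow_mul, neg_sq, inv_eq_iff_eq_inv,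
      ← mul_eq_one_iff_eq_inv₀ (pow_ne_zero _ hβ0), ← hs]
    ring
  · have hk' : (k : ℕ) < n := by omega
    have hne : k ≠ Fin.last n := fun h0 => hk (by rw [h0, Fin.val_last])
    simp only [coe_finRotate_of_ne_last hne]
    set j : ℕ := (k : ℕ)
    have h0 : (-(α * β)) ^ j * α ≠ 0 := by
      have := hnorm j
      intro h0; rw [h0] at this; simp at this
    refine blockFactorization_of_norm_lt hα hβ (hnorm _) (by rw [norm_inv, hnorm, inv_one]) ?_ ?_
    · rw [pow_succ']; field_simp
    · have hlt := norm_one_sub_lt_of_chordBound_lt hα hβ hP h (k := j) (by omega)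
      convert hlt using 1
      have : (-(α * β)) ^ (j + 1) * α + ((-(α * β)) ^ j * α)⁻¹
          = ((-(α * β)) ^ j * α)⁻¹ * (1 - α ^ 2 * (α * β) ^ (2 * j + 1)) := by
        rw [eq_inv_mul_iff_mul_eq₀ h0, mul_add, mul_inv_cancel₀ h0]
        have hsq : (-(α * β)) ^ j * (-(α * β)) ^ j = (α * β) ^ (2 * j) := by
          rw [← mul_pow, neg_mul_neg, ← sq, ← pow_mul]
        linear_combination -(α ^ 2 * (α * β)) * hsq
      rw [this, norm_mul, norm_inv, hnorm, inv_one, one_mul]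

theorem theorem3p24 (d r : ℕ) (hd : 4 ≤ d) (hdr : d = r + r) (α β : ℂ)
    (hα : ‖α‖ = 1) (hβ : ‖β‖ = 1) (hαβ : α ≠ β) (hP : ConditionP r r α β) :
    twoEigMatrix r r α β ∈ SymProd 3 (Fin r ⊕ Fin r) ↔
      ((4 ∣ d ∧ (α * β) ^ r = -1 ∧
          ∀ j : ℕ, 1 ≤ j → j ≤ r → ‖(α * β) ^ (2 * j - 1) - 1‖ < ‖α - β‖) ∨
        (¬ 4 ∣ d ∧
          ∀ j : ℕ, 1 ≤ j → j ≤ r → ‖(α * β) ^ (2 * j - 1) - 1‖ < ‖α - β‖) ∨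
        (¬ 4 ∣ d ∧ (α * β) ^ r = -1 ∧
          ‖Complex.exp (Complex.I * (((r : ℂ) - 1) / (r : ℂ)) * (Real.pi : ℂ)) - 1‖ < ‖α - β‖) ∨
        (¬ 4 ∣ d ∧ (α * β) ^ r = -1 ∧
          ∀ j : ℕ, 1 ≤ j → j ≤ r - 1 →
            ‖1 - α ^ (2 * j + 1) * β ^ (2 * j - 1)‖ < ‖α - β‖)) := by
  have hr : 2 ≤ r := by omega
  rw [← chordBound_lt_iff_conditions hd hdr hα hβ hP]
  exact ⟨chordBound_lt_of_mem_symProd hr hα hβ hαβ hP, mem_symProd_of_chordBound_lt hr hα hβ hP⟩
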